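/- Conventions. All groups are abelian, written additively. For a family $(A_i)_{i\in I}$ of abelian groups and an ultrafilter $\mathcal U$ on $I$, the ultraproduct $\prod_{i\in I}A_i/\mathcal U$ is the quotient of $\prod_{i\in I}A_i$ by the subgroup of those $x$ with $\{i : x_i=0\}\in\mathcal U$. It is called countably complete if $\mathcal U$ is closed under countable intersections (so principal ultrafilters are allowed). A homomorphism $f:\prod_{i\in I}A_i\to B$ factors through the product of finitely many ultraproducts if there are finitely many ultrafilters $\mathcal U_0,\dots,\mathcal U_{m-1}$ on $I$ ($m\ge 0$) and a homomorphism $g:\prod_{k<m}\bigl(\prod_{i\in I}A_i/\mathcal U_k\bigr)\to B$ such that $f$ is the composite of $g$ with the natural map $\prod_{i\in I}A_i\to\prod_{k<m}\bigl(\prod_{i\in I}A_i/\mathcal U_k\bigr)$; it factors through the product of finitely many of the $A_i$ if there are a finite set $S\subseteq I$ and a homomorphism $g:\prod_{i\in S}A_i\to B$ such that $f$ is the composite of $g$ with the projection $\prod_{i\in I}A_i\to\prod_{i\in S}A_i$. A subgroup $C$ of $A$ is pure if $C\cap nA=nC$ for every positive integer $n$. A group $C$ is algebraically compact if it is a direct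 summand in every abelian group $A\supseteq C$ in which it is pure, and cotorsion if it is a direct summand in every abelian group $A\supseteq C$ such that $A/C$ is torsion-free. Theorem. For every abelian group $B$ the following conditions are equivalent. 1. There exist a set $I$, a family of abelian groups $(A_i)_{i\in I}$, and a surjective homomorphism $f:\prod_{i\in I}A_i\to B$ such that $f$ factors through the product of finitely many ultraproducts $\prod_{i\in I}A_i/\mathcal U_k$, but does not factor through the product of finitely many countably complete ultraproducts of the $A_i$. 2. There exist a countable family $(A_n)_{n\in\mathbb N}$ of abelian groups and a surjective homomorphism $f:\prod_{n\in\mathbb N}A_n\to B$ such that $f$ factors through the product of finitely many ultraproducts $\prod_{n\in\mathbb N}A_n/\mathcal U_k$, but does not factor through the product of finitely many of the $A_n$. 3. $B$ has a nonzero cotorsion subgroup. 4. $B$ has a nonzero element of finite order, or contains a subgroup isomorphic to the additive group $\mathbb Q$, or, for some prime $p$, contains a subgroup isomorphic to the additive group $\mathbb Z_p$ of $p$-adic integers. 5. $B$ has a nonzero algebraically compact subgroup. 6. The condition obtained from condition 1 by omitting the word "surjective". 7. The condition obtained from condition 2 by omitting the word "surjective". -/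

import Mathlib

universe u v w

/-- For a filter `F` on `I`, the subgroup of `∏ i, A i` consisting of the families that vanish
on a member of `F`. -/
def eventuallyZeroSubgroup {I : Type v} (A : I → Type w) [∀ i, AddCommGroup (A i)]
    (F : Filter I) : AddSubgroup (∀ i, A i) where
  carrier := {x | ∀ᶠ i in F, x i = 0}
  zero_mem' := Filter.Eventually.of_forall fun _ => rfl
  add_mem' {x y} hx hy := by
    filter_upwards [hx, hy] with i h1 h2
    simp [h1, h2]
  neg_mem' {x} hx := by
    filter_upwards [hx] with i h1
    simp [h1]

/-- The ultraproduct `(∏ i, A i) / U` of a family of abelian groups, with its group structure: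
two families are identified when they agree on a member of `U`. -/
abbrev Ultraproduct {I : Type v} (A : I → Type w) [∀ i, AddCommGroup (A i)]
    (U : Ultrafilter I) : Type (max v w) :=
  (∀ i, A i) ⧸ eventuallyZeroSubgroup A (U : Filter I)

/-- The natural map from the product to the ultraproduct. -/
def Ultraproduct.mk {I : Type v} (A : I → Type w) [∀ i, AddCommGroup (A i)]
    (U : Ultrafilter I) : (∀ i, A i) →+ Ultraproduct A U :=
  QuotientAddGroup.mk' _

theorem Ultraproduct.mk_eq_mk_iff {I : Type v} (A : I → Type w) [∀ i, AddCommGroup (A i)]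
    (U : Ultrafilter I) (x y : ∀ i, A i) :
    Ultraproduct.mk A U x = Ultraproduct.mk A U y ↔ ∀ᶠ i in (U : Filter I), x i = y i := by
  unfold Ultraproduct.mk
  rw [QuotientAddGroup.mk'_apply, QuotientAddGroup.mk'_apply, QuotientAddGroup.eq]
  refine Filter.eventually_congr (Filter.Eventually.of_forall fun i => ?_)
  simp only [Pi.add_apply, Pi.neg_apply]
  rw [neg_add_eq_zero]

/-- `f` factors, as a group homomorphism, through the natural map from `∏ i, A i` to the direct
product of finitely many ultraproducts `(∏ i, A i) / U 0, …, (∏ i, A i) / U (m - 1)`. -/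
def FactorsThroughUltraproducts {I : Type v} {A : I → Type w} [∀ i, AddCommGroup (A i)]
    {B : Type u} [AddCommGroup B] (f : (∀ i, A i) →+ B) : Prop :=
  ∃ (m : ℕ) (U : Fin m → Ultrafilter I) (g : (∀ k, Ultraproduct A (U k)) →+ B),
    ∀ x, f x = g (fun k => Ultraproduct.mk A (U k) x)

/-- The same, with all the ultrafilters countably complete (closed under countable
intersections; principal ultrafilters are countably complete). -/
def FactorsThroughCountablyCompleteUltraproducts {I : Type v} {A : I → Type w}
    [∀ i, AddCommGroup (A i)] {B : Type u} [AddCommGroup B] (f : (∀ i, A i) →+ B) : Prop :=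
  ∃ (m : ℕ) (U : Fin m → Ultrafilter I) (g : (∀ k, Ultraproduct A (U k)) →+ B),
    (∀ k, CountableInterFilter (U k : Filter I)) ∧
      ∀ x, f x = g (fun k => Ultraproduct.mk A (U k) x)

/-- `f` factors, as a group homomorphism, through the projection of `∏ i, A i` onto the direct
product of finitely many of the `A i`. -/
def FactorsThroughFiniteSubproduct {I : Type v} {A : I → Type w} [∀ i, AddCommGroup (A i)]
    {B : Type u} [AddCommGroup B] (f : (∀ i, A i) →+ B) : Prop :=
  ∃ (S : Finset I) (g : (∀ i : S, A i) →+ B), ∀ x, f x = g (fun i : S => x i)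

/-- A subgroup `H` of an abelian group `A` is pure if `H ∩ nA = nH` for every positive
integer `n`. (The inclusion `⊇` is automatic.) -/
def IsPureSubgroup {A : Type u} [AddCommGroup A] (H : AddSubgroup A) : Prop :=
  ∀ n : ℕ, 0 < n → ∀ b ∈ H, (∃ a : A, n • a = b) → ∃ c ∈ H, n • c = b

/-- A subgroup `H` of an abelian group `A` is a direct summand. -/
def IsDirectSummand {A : Type u} [AddCommGroup A] (H : AddSubgroup A) : Prop :=
  ∃ K : AddSubgroup A, IsCompl H K

/-- `B` is algebraically compact: it is a direct summand in every abelian overgroup in which it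
is pure. Overgroups are given by injective homomorphisms `B →+ A`. -/
def IsAlgebraicallyCompact (B : Type u) [AddCommGroup B] : Prop :=
  ∀ (A : Type u) [AddCommGroup A] (i : B →+ A), Function.Injective i →
    IsPureSubgroup i.range → IsDirectSummand i.range

/-- `B` is cotorsion: it is a direct summand in every abelian overgroup `A` with `A / B`
torsion-free. -/
def IsCotorsion (B : Type u) [AddCommGroup B] : Prop :=
  ∀ (A : Type u) [AddCommGroup A] (i : B →+ A), Function.Injective i →
    IsAddTorsionFree (A ⧸ i.range) → IsDirectSummand i.range

/-! ### Direct summands and retractions -/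

section Summands

variable {A : Type u} [AddCommGroup A] {C : Type v} [AddCommGroup C]

/-! The core is that condition 6 implies condition 4. Factoring through ultraproducts means being a
finite sum of maps `F k`, each killing families that vanish on a member of `U k`. If `U k` is not
countably complete, some `n : I → ℕ` tends to infinity along it. Suppose `B` is torsion-free without
a copy of `ℚ`. Then `F k` kills every family divisible by all integers along `U k`, since such
families have a divisible image. If `F k ≠ 0`, its range is not divisible, so some `F k a` is not in
`p` times the range. Multiplying `a i` by approximations of `z` modulo `p ^ n i`, corrected to kill
the prime-to-`p` error, gives a nonzero map from `ℤ_[p]`, which must be injective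
(`exists_torsion_or_embedding_of_tendsto`). Failing all three alternatives, only countably complete
ultrafilters contribute.

Conversely, `ZMod N`, `ℚ` and `ℤ_[p]` split off wherever they are pure, and algebraically compact
groups are cotorsion. The diagonal of `ℤ` in a nonprincipal ultrapower has torsion-free cokernel, so
a nonzero map from `ℤ` to a cotorsion subgroup extends to the ultrapower. Adding a coordinate
projection onto `B` makes the resulting map surjective. -/

theorem isDirectSummand_range_of_retraction (i : C →+ A) (r : A →+ C) (h : ∀ c, r (i c) = c) :
    IsDirectSummand i.range := by
  refine ⟨r.ker, ?_, ?_⟩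
  · rw [AddSubgroup.disjoint_def]
    rintro _ ⟨c, rfl⟩ hc
    rw [AddMonoidHom.mem_ker, h] at hc
    rw [hc, map_zero]
  · rw [codisjoint_iff, eq_top_iff]
    intro a _
    rw [AddSubgroup.mem_sup]
    refine ⟨i (r a), ⟨_, rfl⟩, a - i (r a), ?_, by abel⟩
    rw [AddMonoidHom.mem_ker, map_sub, h, sub_self]

theorem IsDirectSummand.exists_retraction {i : C →+ A} (hi : Function.Injective i)
    (h : IsDirectSummand i.range) : ∃ r : A →+ C, ∀ c, r (i c) = c := by
  obtain ⟨K, hK⟩ := h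
  have hdecomp : ∀ a, ∃ c, a - i c ∈ K := fun a => by
    have ha : a ∈ i.range ⊔ K := by rw [hK.sup_eq_top]; trivial
    obtain ⟨_, ⟨c, rfl⟩, k, hk, rfl⟩ := AddSubgroup.mem_sup.1 ha
    exact ⟨c, by simpa using hk⟩
  have huniq : ∀ c, i c ∈ K → c = 0 := fun c hc => by
    have := (AddSubgroup.disjoint_def.1 hK.disjoint) ⟨c, rfl⟩ hc
    exact hi (by rw [this, map_zero])
  choose r hr using hdecomp
  refine ⟨AddMonoidHom.mk' r fun a b => ?_, fun c => ?_⟩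
  · refine sub_eq_zero.1 (huniq _ ?_)
    have := K.sub_mem (K.add_mem (hr a) (hr b)) (hr (a + b))
    simp only [map_sub, map_add]
    convert this using 1
    abel
  · refine (sub_eq_zero.1 (huniq _ ?_)).symm
    rw [map_sub]
    exact hr (i c)

end Summands

/-! ### Algebraically compact groups -/

theorem IsAlgebraicallyCompact.isCotorsion {C : Type u} [AddCommGroup C]
    (hC : IsAlgebraicallyCompact C) : IsCotorsion C := by
  intro A _ i hi htf
  -- A torsion-free quotient forces purity: if `n • a` lies in the subgroup, so does `a`.
  refine hC A i hi fun n hn b hb ⟨a, ha⟩ => ⟨a, ?_, ha⟩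
  have h : n • (a : A ⧸ i.range) = n • 0 := by
    rw [smul_zero, ← QuotientAddGroup.mk_nsmul, ha]
    exact (QuotientAddGroup.eq_zero_iff b).2 hb
  exact (QuotientAddGroup.eq_zero_iff a).1 (htf.nsmul_right_injective hn.ne' h)

/-- Transport of algebraic compactness along an isomorphism, across universes. -/
theorem isAlgebraicallyCompact_of_addEquiv {X : Type v} [AddCommGroup X] {C : Type u}
    [AddCommGroup C] (e : X ≃+ C)
    (h : ∀ (A : Type u) [AddCommGroup A] (i : X →+ A), Function.Injective i →
      IsPureSubgroup i.range → ∃ r : A →+ X, ∀ x, r (i x) = x) :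
    IsAlgebraicallyCompact C := by
  intro A _ i hi hp
  have hr : (i.comp e.toAddMonoidHom).range = i.range :=
    SetLike.coe_injective (by simp)
  obtain ⟨r, hr⟩ := h A (i.comp e.toAddMonoidHom) (hi.comp e.injective) (hr ▸ hp)
  refine isDirectSummand_range_of_retraction i (e.toAddMonoidHom.comp r) fun c => ?_
  have := hr (e.symm c)
  simp only [AddMonoidHom.comp_apply, AddEquiv.coe_toAddMonoidHom, e.apply_symm_apply] at this ⊢
  rw [this, e.apply_symm_apply]

/-- A homomorphism from a subgroup to a divisible group extends. -/
theorem exists_extension_of_divisible {X A D : Type*} [AddCommGroup X] [AddCommGroup A]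
    [AddCommGroup D] (hD : ∀ n : ℤ, n ≠ 0 → ∀ d : D, ∃ e, n • e = d)
    (i : X →+ A) (hi : Function.Injective i) (f : X →+ D) : ∃ r : A →+ D, ∀ x, r (i x) = f x := by
  choose div hdiv using hD
  have : DivisibleBy D ℤ :=
    { div := fun d n => if hn : n = 0 then 0 else div n hn d
      div_zero := fun d => by simp
      div_cancel := fun d hn => by simp [hn, hdiv] }
  obtain ⟨h, hh⟩ := (Module.Baer.of_divisible D).extension_property_addMonoidHom i hi f
  exact ⟨h, DFunLike.congr_fun hh⟩

/-- Characters with values in `ZMod N` extend from a pure subgroup. -/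
theorem exists_extension_zmod_of_pure {X A : Type*} [AddCommGroup X] [AddCommGroup A]
    (N : ℕ) [NeZero N] (i : X →+ A) (hi : Function.Injective i)
    (hp : IsPureSubgroup i.range) (f : X →+ ZMod N) :
    ∃ r : A →+ ZMod N, ∀ x, r (i x) = f x := by
  let q := QuotientAddGroup.mk' (nsmulAddMonoidHom (α := A) N).range
  let j : X ⧸ (nsmulAddMonoidHom (α := X) N).range →+
      A ⧸ (nsmulAddMonoidHom (α := A) N).range :=
    QuotientAddGroup.map _ _ i (by rintro _ ⟨x, rfl⟩; exact ⟨i x, by simp⟩)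
  -- Purity is what makes `X / NX → A / NA` injective.
  have hj : Function.Injective j := by
    rw [injective_iff_map_eq_zero]
    intro x
    induction x using QuotientAddGroup.induction_on with
    | H x =>
    intro hx
    obtain ⟨a, ha⟩ := (QuotientAddGroup.eq_zero_iff (i x)).1 hx
    obtain ⟨_, ⟨c, rfl⟩, hc⟩ := hp N (NeZero.pos N) (i x) ⟨x, rfl⟩ ⟨a, ha⟩
    exact (QuotientAddGroup.eq_zero_iff x).2 ⟨c, hi (by simpa using hc)⟩
  let f' : X ⧸ (nsmulAddMonoidHom (α := X) N).range →+ ZMod N :=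
    QuotientAddGroup.lift _ f (by rintro _ ⟨x, rfl⟩; simp)
  obtain ⟨g, hg⟩ := exists_extension_of_divisible (D := UnitAddCircle) (fun n hn d =>
    ⟨DivisibleBy.div d n, DivisibleBy.div_cancel d hn⟩) j hj (ZMod.toAddCircle.comp f')
  -- The extension takes values in the `N`-torsion of the circle, which is the image of `ZMod N`.
  have hmem : ∀ a, ∃ k : ZMod N, ZMod.toAddCircle k = g (q a) := fun a => by
    have h0 : N • g (q a) = 0 := by
      rw [← map_nsmul, ← map_nsmul]
      have : q (N • a) = 0 := (QuotientAddGroup.eq_zero_iff _).2 ⟨a, rfl⟩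
      rw [this, map_zero]
    obtain ⟨m, -, hm⟩ := (AddCircle.nsmul_eq_zero_iff (p := (1 : ℝ)) (NeZero.pos N)).1 h0
    exact ⟨m, by rw [← hm, ZMod.toAddCircle_natCast]; simp⟩
  choose r hr using hmem
  refine ⟨AddMonoidHom.mk' r fun a b => ZMod.toAddCircle_injective N ?_, fun x =>
    ZMod.toAddCircle_injective N ?_⟩
  · simp only [map_add, hr]
  · exact (hr (i x)).trans (hg x)

theorem exists_retraction_zmod {A : Type*} [AddCommGroup A] (N : ℕ) [NeZero N] (i : ZMod N →+ A)
    (hi : Function.Injective i) (hp : IsPureSubgroup i.range) :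
    ∃ r : A →+ ZMod N, ∀ x, r (i x) = x :=
  exists_extension_zmod_of_pure N i hi hp (AddMonoidHom.id _)

/-- A compactness argument: maps that are retractions up to an error in `p ^ n ℤ_[p]` form nested
nonempty closed sets in the compact space `A → ℤ_[p]`, and a common point is an exact retraction. -/
theorem exists_retraction_padicInt {A : Type*} [AddCommGroup A] (p : ℕ) [Fact p.Prime]
    (i : ℤ_[p] →+ A) (hi : Function.Injective i) (hp : IsPureSubgroup i.range) :
    ∃ r : A →+ ℤ_[p], ∀ x, r (i x) = x := by
  let K : ℕ → Set (A → ℤ_[p]) := fun n =>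
    {f | (∀ a b, ‖f (a + b) - f a - f b‖ ≤ (p : ℝ) ^ (-n : ℤ)) ∧
      ∀ x, ‖f (i x) - x‖ ≤ (p : ℝ) ^ (-n : ℤ)}
  have hp1 : (1 : ℝ) < p := by exact_mod_cast (Fact.out : p.Prime).one_lt
  have hcl : ∀ n, IsClosed (K n) := fun n => by
    simp only [K, Set.ofPred_and, Set.ofPred_forall]
    refine (isClosed_iInter fun a => isClosed_iInter fun b => ?_).inter
      (isClosed_iInter fun x => ?_)
    · exact isClosed_le (by fun_prop) continuous_const
    · exact isClosed_le (by fun_prop) continuous_const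
  have hne : ∀ n, (K n).Nonempty := fun n => by
    obtain ⟨r, hr⟩ := exists_extension_zmod_of_pure (p ^ n) i hi hp
      (PadicInt.toZModPow n).toAddMonoidHom
    refine ⟨fun a => ((r a).val : ℤ_[p]), fun a b => ?_, fun x => ?_⟩
    all_goals
      rw [PadicInt.norm_le_pow_iff_mem_span_pow, ← PadicInt.ker_toZModPow, RingHom.mem_ker]
      simp only [map_sub, ZMod.natCast_val, map_add, hr]
      simp
  have hanti : ∀ n, K (n + 1) ⊆ K n := fun n f hf => by
    have : (p : ℝ) ^ (-(n + 1 : ℕ) : ℤ) ≤ (p : ℝ) ^ (-n : ℤ) :=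
      zpow_le_zpow_right₀ hp1.le (by push_cast; omega)
    exact ⟨fun a b => (hf.1 a b).trans this, fun x => (hf.2 x).trans this⟩
  obtain ⟨f, hf⟩ := IsCompact.nonempty_iInter_of_sequence_nonempty_isCompact_isClosed K hanti hne
    (hcl 0).isCompact hcl
  rw [Set.mem_iInter] at hf
  have hzero : ∀ z : ℤ_[p], (∀ n : ℕ, ‖z‖ ≤ (p : ℝ) ^ (-n : ℤ)) → z = 0 := fun z hz => by
    by_contra hz0
    obtain ⟨n, hn⟩ := PadicInt.exists_pow_neg_lt p (norm_pos_iff.2 hz0)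
    exact (hz n).not_gt hn
  refine ⟨AddMonoidHom.mk' f fun a b => ?_, fun x => ?_⟩
  · rw [← sub_eq_zero, ← sub_sub]
    exact hzero _ fun n => (hf n).1 a b
  · exact sub_eq_zero.1 (hzero _ fun n => (hf n).2 x)

/-- A group with torsion, or containing `ℚ` or some `ℤ_[p]`, has a nonzero algebraically compact
subgroup. -/
theorem exists_isAlgebraicallyCompact_addSubgroup {B : Type u} [AddCommGroup B]
    (h : (∃ b : B, b ≠ 0 ∧ IsOfFinAddOrder b) ∨ (∃ i : ℚ →+ B, Function.Injective i) ∨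
      (∃ (p : ℕ) (_ : Fact p.Prime) (i : ℤ_[p] →+ B), Function.Injective i)) :
    ∃ C : AddSubgroup B, C ≠ ⊥ ∧ IsAlgebraicallyCompact C := by
  have key : ∀ {X : Type} [AddCommGroup X] [Nontrivial X] (j : X →+ B)
      (_ : Function.Injective j)
      (_ : ∀ (A : Type u) [AddCommGroup A] (i : X →+ A), Function.Injective i →
        IsPureSubgroup i.range → ∃ r : A →+ X, ∀ x, r (i x) = x),
      ∃ C : AddSubgroup B, C ≠ ⊥ ∧ IsAlgebraicallyCompact C := by
    intro X _ _ j hj hX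
    refine ⟨j.range, fun hbot => ?_, isAlgebraicallyCompact_of_addEquiv
      (AddMonoidHom.ofInjective hj) hX⟩
    obtain ⟨x, hx⟩ := exists_ne (0 : X)
    have : j x ∈ j.range := ⟨x, rfl⟩
    rw [hbot, AddSubgroup.mem_bot] at this
    exact hx (hj (this.trans (map_zero j).symm))
  rcases h with ⟨b, hb0, hb⟩ | ⟨i, hi⟩ | ⟨p, _, i, hi⟩
  · have hpos : 0 < addOrderOf b := hb.addOrderOf_pos
    have : NeZero (addOrderOf b) := ⟨hpos.ne'⟩
    have : Fact (1 < addOrderOf b) := ⟨by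
      have : addOrderOf b ≠ 1 := fun h => hb0 (AddMonoid.addOrderOf_eq_one_iff.1 h)
      omega⟩
    refine key (ZMod.lift (addOrderOf b) ⟨zmultiplesHom B b, by simp⟩) ?_
      fun A _ i hi hp => exists_retraction_zmod _ i hi hp
    rw [ZMod.lift_injective]
    intro m hm
    rw [ZMod.intCast_zmod_eq_zero_iff_dvd]
    exact addOrderOf_dvd_iff_zsmul_eq_zero.2 hm
  · refine key i hi fun A _ j hj _ => exists_extension_of_divisible (D := ℚ) (fun n hn q => ⟨q / n, ?_⟩) j hj
      (AddMonoidHom.id ℚ)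
    rw [zsmul_eq_mul]
    field_simp
  · exact key i hi fun A _ j hj hp => exists_retraction_padicInt p j hj hp

/-! ### Factorizations as finite sums of homomorphisms -/

section Factorization

variable {I : Type v} {A : I → Type w} [∀ i, AddCommGroup (A i)] {B : Type u} [AddCommGroup B]

/-- Factoring through a product of finitely many ultraproducts, restated as a decomposition into a
finite sum of homomorphisms each of which vanishes on the families vanishing almost everywhere. -/
theorem factors_iff_sum (Q : Ultrafilter I → Prop) (f : (∀ i, A i) →+ B) :
    (∃ (m : ℕ) (U : Fin m → Ultrafilter I) (g : (∀ k, Ultraproduct A (U k)) →+ B),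
      (∀ k, Q (U k)) ∧ ∀ x, f x = g (fun k => Ultraproduct.mk A (U k) x)) ↔
    ∃ (m : ℕ) (U : Fin m → Ultrafilter I) (F : Fin m → (∀ i, A i) →+ B),
      (∀ k, Q (U k)) ∧ (∀ k x, (∀ᶠ i in (U k : Filter I), x i = 0) → F k x = 0) ∧
        ∀ x, f x = ∑ k, F k x := by
  constructor
  · rintro ⟨m, U, g, hQ, hg⟩
    refine ⟨m, U, fun k => (g.comp (AddMonoidHom.single _ k)).comp (Ultraproduct.mk A (U k)), hQ,
      fun k x hx => ?_, fun x => ?_⟩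
    · have : Ultraproduct.mk A (U k) x = 0 := (QuotientAddGroup.eq_zero_iff x).2 hx
      simp [this]
    · rw [hg, ← Finset.univ_sum_single (fun k => Ultraproduct.mk A (U k) x), map_sum]
      rfl
  · rintro ⟨m, U, F, hQ, hF, hf⟩
    refine ⟨m, U, ∑ k, (QuotientAddGroup.lift (eventuallyZeroSubgroup A (U k : Filter I)) (F k)
      fun x hx => hF k x hx).comp (Pi.evalAddMonoidHom _ k), hQ, fun x => ?_⟩
    rw [hf, AddMonoidHom.finsetSum_apply]
    rfl

theorem factorsThroughUltraproducts_iff_sum (f : (∀ i, A i) →+ B) :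
    FactorsThroughUltraproducts f ↔
    ∃ (m : ℕ) (U : Fin m → Ultrafilter I) (F : Fin m → (∀ i, A i) →+ B),
      (∀ k x, (∀ᶠ i in (U k : Filter I), x i = 0) → F k x = 0) ∧ ∀ x, f x = ∑ k, F k x := by
  simpa [FactorsThroughUltraproducts] using factors_iff_sum (fun _ => True) f

theorem factorsThroughCountablyCompleteUltraproducts_iff_sum (f : (∀ i, A i) →+ B) :
    FactorsThroughCountablyCompleteUltraproducts f ↔
    ∃ (m : ℕ) (U : Fin m → Ultrafilter I) (F : Fin m → (∀ i, A i) →+ B),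
      (∀ k, CountableInterFilter (U k : Filter I)) ∧
      (∀ k x, (∀ᶠ i in (U k : Filter I), x i = 0) → F k x = 0) ∧ ∀ x, f x = ∑ k, F k x :=
  factors_iff_sum (fun U : Ultrafilter I => CountableInterFilter (U : Filter I)) f

theorem factorsThroughFiniteSubproduct_iff (f : (∀ i, A i) →+ B) :
    FactorsThroughFiniteSubproduct f ↔
      ∃ S : Finset I, ∀ x, (∀ i ∈ S, x i = 0) → f x = 0 := by
  classical
  constructor
  · rintro ⟨S, g, hg⟩
    refine ⟨S, fun x hx => ?_⟩
    have : (fun i : S => x i) = 0 := funext fun i => hx i i.2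
    rw [hg, this, map_zero]
  · rintro ⟨S, hS⟩
    let ext : (∀ i : S, A i) →+ ∀ i, A i :=
      { toFun := fun y i => if h : i ∈ S then y ⟨i, h⟩ else 0
        map_zero' := by ext i; simp
        map_add' := fun y z => by
          ext i
          by_cases h : i ∈ S <;> simp [h] }
    refine ⟨S, f.comp ext, fun x => sub_eq_zero.1 ?_⟩
    rw [AddMonoidHom.comp_apply, ← map_sub]
    exact hS _ fun i hi => by simp [ext, hi]

end Factorization

/-! ### Countable completeness of ultrafilters -/

theorem Ultrafilter.exists_eq_pure_of_countableInterFilter {I : Type v} [Countable I]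
    (U : Ultrafilter I) [CountableInterFilter (U : Filter I)] : ∃ i, U = pure i := by
  by_contra! h
  have h' : ∀ i, ∀ᶠ j in (U : Filter I), j ≠ i := fun i => by
    rw [Ultrafilter.eventually_not]
    exact fun hi => h i (Ultrafilter.coe_le_coe.1 (Filter.le_pure_iff.2 hi))
  have := eventually_countable_forall.2 h'
  obtain ⟨j, hj⟩ := this.exists
  exact hj j rfl

theorem Ultrafilter.exists_tendsto_atTop_of_not_countableInterFilter {I : Type v}
    (U : Ultrafilter I) (hU : ¬ CountableInterFilter (U : Filter I)) :
    ∃ n : I → ℕ, Filter.Tendsto n U Filter.atTop := by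
  classical
  have : ∃ S : Set (Set I), S.Countable ∧ (∀ s ∈ S, s ∈ (U : Filter I)) ∧
      ⋂₀ S ∉ (U : Filter I) := by
    by_contra! h
    exact hU ⟨h⟩
  obtain ⟨S, hS, hmem, hnot⟩ := this
  have hne : S.Nonempty := by
    rw [Set.nonempty_iff_ne_empty]
    rintro rfl
    exact hnot (by simp)
  obtain ⟨s, rfl⟩ := hS.exists_eq_range hne
  have hev : ∀ᶠ i in (U : Filter I), ∃ j, i ∉ s j := by
    filter_upwards [Ultrafilter.compl_mem_iff_notMem.2 hnot] with i hi
    simpa using hi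
  -- The value is the first `j` with `i ∉ s j`. The default 0 occurs only off a member of `U`.
  refine ⟨fun i => if h : ∃ j, i ∉ s j then Nat.find h else 0, Filter.tendsto_atTop.2 fun N => ?_⟩
  have hall : ∀ᶠ i in (U : Filter I), ∀ j ∈ Finset.range N, i ∈ s j :=
    (Filter.eventually_all_finset _).2 fun j _ => hmem _ ⟨j, rfl⟩
  filter_upwards [hev, hall] with i h1 h2
  rw [dif_pos h1, Nat.le_find_iff]
  exact fun m hm => not_not.2 (h2 m (Finset.mem_range.2 hm))

/-- On a countable index set, countably complete ultrafilters are principal, so such a factorization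
involves only finitely many coordinates. The lift moves `ℕ` to the universe of the index set. -/
theorem not_factorsThroughCountablyComplete_ulift {A : ℕ → Type w} [∀ n, AddCommGroup (A n)]
    {B : Type u} [AddCommGroup B] {f : (∀ n, A n) →+ B} (h1 : FactorsThroughUltraproducts f)
    (h2 : ¬ FactorsThroughFiniteSubproduct f) :
    ∃ f' : (∀ i : ULift.{v} ℕ, A i.down) →+ B, (∀ b, (∃ x, f x = b) → ∃ x, f' x = b) ∧
      FactorsThroughUltraproducts f' ∧ ¬ FactorsThroughCountablyCompleteUltraproducts f' := by
  let t : (∀ i : ULift.{v} ℕ, A i.down) →+ ∀ n, A n :=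
    { toFun := fun x n => x ⟨n⟩, map_zero' := rfl, map_add' := fun _ _ => rfl }
  refine ⟨f.comp t, ?_, ?_, ?_⟩
  · rintro b ⟨x, rfl⟩
    exact ⟨fun i => x i.down, rfl⟩
  · rw [factorsThroughUltraproducts_iff_sum] at h1 ⊢
    obtain ⟨m, U, F, hF, hf⟩ := h1
    exact ⟨m, fun k => (U k).map ULift.up, fun k => (F k).comp t,
      fun k x hx => hF k _ hx, fun x => hf _⟩
  · rw [factorsThroughCountablyCompleteUltraproducts_iff_sum]
    rintro ⟨m, U, F, hU, hF, hf⟩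
    choose i hi using fun k =>
      have := hU k
      (U k).exists_eq_pure_of_countableInterFilter
    refine h2 ((factorsThroughFiniteSubproduct_iff f).2
      ⟨Finset.univ.image fun k => (i k).down, fun x hx => ?_⟩)
    have := hf fun i => x i.down
    rw [Finset.sum_eq_zero fun k _ => hF k _ ?_] at this
    · exact this
    · rw [hi k]
      exact hx _ (Finset.mem_image_of_mem _ (Finset.mem_univ k))

/-- Homomorphisms to a cotorsion group extend along embeddings with torsion-free cokernel. -/
theorem IsCotorsion.exists_extension {C : Type u} [AddCommGroup C] (hC : IsCotorsion C)
    {H G : Type} [AddCommGroup H] [AddCommGroup G] (j : H →+ G) (hj : Function.Injective j)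
    (hp : ∀ n : ℕ, 0 < n → ∀ g : G, n • g ∈ j.range → g ∈ j.range) (f : H →+ C) :
    ∃ φ : G →+ C, ∀ x, φ (j x) = f x := by
  -- The quotient by `R` is the pushout of `f` and `j`; there `C` embeds with cokernel `G / j(H)`,
  -- which is torsion-free.
  let R : AddSubgroup (C × G) := (f.prod (-j)).range
  let q := QuotientAddGroup.mk' R
  let i : C →+ (C × G) ⧸ R := q.comp (AddMonoidHom.inl C G)
  have hq : ∀ y, q y = 0 ↔ ∃ x, f x = y.1 ∧ - j x = y.2 := fun y => by
    rw [← AddMonoidHom.mem_ker, QuotientAddGroup.ker_mk']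
    simp [R, AddMonoidHom.mem_range, Prod.ext_iff]
  have hi : Function.Injective i := by
    rw [injective_iff_map_eq_zero]
    intro c hc
    obtain ⟨x, hx, hx'⟩ := (hq _).1 hc
    have : x = 0 := hj (by simpa using hx')
    subst this
    simpa using hx.symm
  have htf : IsAddTorsionFree (((C × G) ⧸ R) ⧸ i.range) := by
    constructor
    intro n hn
    refine (injective_iff_map_eq_zero (nsmulAddMonoidHom (α := ((C × G) ⧸ R) ⧸ i.range) n)).2 ?_
    intro a ha
    induction a using QuotientAddGroup.induction_on with
    | H a =>
    induction a using QuotientAddGroup.induction_on with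
    | H a =>
    obtain ⟨c, g⟩ := a
    obtain ⟨c', hc'⟩ : n • q (c, g) ∈ i.range := (QuotientAddGroup.eq_zero_iff _).1 ha
    obtain ⟨x, -, hx⟩ := (hq ((c', 0) - n • (c, g))).1 (by
      rw [map_sub, map_nsmul, ← hc']
      exact sub_self _)
    obtain ⟨y, rfl⟩ := hp n (Nat.pos_of_ne_zero hn) g ⟨x, by simpa using hx⟩
    refine (QuotientAddGroup.eq_zero_iff _).2 ⟨c + f y, sub_eq_zero.1 ?_⟩
    exact (hq ((c + f y, 0) - (c, j y))).2 ⟨y, by simp, by simp⟩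
  obtain ⟨r, hr⟩ := (hC _ i hi htf).exists_retraction hi
  refine ⟨(r.comp q).comp (AddMonoidHom.inr C G), fun x => ?_⟩
  have : q (0, j x) = i (f x) := by
    rw [← sub_eq_zero]
    refine (hq ((0, j x) - (f x, 0))).2 ⟨-x, by simp, by simp⟩
  simp only [AddMonoidHom.comp_apply, AddMonoidHom.inr_apply, this, hr]

/-- Take every factor to be `B × ℤ`: `F0` reads the `B`-part at index 0 and gives surjectivity,
while `F1` sees the `ℤ`-parts only modulo a nonprincipal ultrafilter and so ignores any finite set
of indices. -/
theorem exists_surjective_of_isCotorsion {B : Type u} [AddCommGroup B] {C : AddSubgroup B}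
    (hC0 : C ≠ ⊥) (hC : IsCotorsion C) :
    ∃ (A : ℕ → Type u) (_ : ∀ n, AddCommGroup (A n)) (f : (∀ n, A n) →+ B),
      Function.Surjective f ∧ FactorsThroughUltraproducts f ∧
        ¬ FactorsThroughFiniteSubproduct f := by
  obtain ⟨c, hcC, hc0⟩ := C.bot_or_exists_ne_zero.resolve_left hC0
  let U : Ultrafilter ℕ := Filter.hyperfilter ℕ
  let δ : ℤ →+ Ultraproduct (fun _ : ℕ => ℤ) U :=
    (Ultraproduct.mk (fun _ : ℕ => ℤ) U).comp (Pi.constAddMonoidHom ℕ ℤ)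
  have hδ : Function.Injective δ := fun a b hab => by
    obtain ⟨n, hn⟩ := ((Ultraproduct.mk_eq_mk_iff _ _ _ _).1 hab).exists
    exact hn
  have hpure : ∀ n : ℕ, 0 < n → ∀ g, n • g ∈ δ.range → g ∈ δ.range := by
    intro n hn g ⟨z, hz⟩
    obtain ⟨x, rfl⟩ := QuotientAddGroup.mk_surjective g
    have hx : ∀ᶠ k in (U : Filter ℕ), z = n • x k :=
      (Ultraproduct.mk_eq_mk_iff (fun _ : ℕ => ℤ) U (fun _ => z) (n • x)).1 hz
    obtain ⟨k, hk⟩ := hx.exists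
    refine ⟨x k, (Ultraproduct.mk_eq_mk_iff (fun _ : ℕ => ℤ) U (fun _ => x k) x).2 ?_⟩
    filter_upwards [hx] with l hl
    exact nsmul_right_injective hn.ne' (hk.symm.trans hl)
  obtain ⟨φ, hφ⟩ := hC.exists_extension δ hδ hpure (zmultiplesHom C ⟨c, hcC⟩)
  let F0 : (ℕ → B × ℤ) →+ B := (AddMonoidHom.fst B ℤ).comp (Pi.evalAddMonoidHom _ 0)
  let F1 : (ℕ → B × ℤ) →+ B := ((C.subtype.comp φ).comp (Ultraproduct.mk _ U)).comp
    ((AddMonoidHom.snd B ℤ).compLeft ℕ)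
  have hF1 : ∀ x, (∀ᶠ i in (U : Filter ℕ), x i = 0) → F1 x = 0 := fun x hx => by
    have : Ultraproduct.mk _ U ((AddMonoidHom.snd B ℤ).compLeft ℕ x) = 0 := by
      refine (QuotientAddGroup.eq_zero_iff _).2 ?_
      filter_upwards [hx] with i hi
      simp [hi]
    simp only [F1, AddMonoidHom.comp_apply, this, map_zero]
  refine ⟨fun _ => B × ℤ, inferInstance, F0 + F1, fun b => ⟨fun _ => (b, 0), ?_⟩, ?_, ?_⟩
  · have : (AddMonoidHom.snd B ℤ).compLeft ℕ (fun _ => (b, 0)) = 0 := rfl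
    simp [F0, F1, this]
  · rw [factorsThroughUltraproducts_iff_sum]
    refine ⟨2, ![pure 0, U], ![F0, F1], fun k => ?_, fun x => by simp⟩
    fin_cases k
    · intro x hx
      have : x 0 = 0 := hx
      simp [F0, this]
    · exact hF1
  · rw [factorsThroughFiniteSubproduct_iff]
    rintro ⟨S, hS⟩
    -- This family vanishes on `S` and at 0 but has the diagonal class of 1, so `F0` kills it and
    -- `F1` sends it to `c`.
    let x : ℕ → B × ℤ := fun n => if n ∈ insert 0 S then 0 else (0, 1)
    have hx0 : ∀ n ∈ insert 0 S, x n = 0 := fun n hn => if_pos hn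
    have h := hS x fun n hn => hx0 n (Finset.mem_insert_of_mem hn)
    have h0 : F0 x = 0 := by simp [F0, hx0 0 (Finset.mem_insert_self _ _)]
    have hev : ∀ᶠ n in (U : Filter ℕ), n ∉ insert 0 S := by
      refine Filter.hyperfilter_le_cofinite ?_
      exact (insert 0 S).finite_toSet.compl_mem_cofinite
    have h1 : Ultraproduct.mk _ U ((AddMonoidHom.snd B ℤ).compLeft ℕ x) = δ 1 := by
      refine (Ultraproduct.mk_eq_mk_iff _ _ _ _).2 ?_
      filter_upwards [hev] with n hn
      simp only [AddMonoidHom.compLeft_apply, Function.comp_apply, x, if_neg hn]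
      rfl
    have h2 : F1 x = c := by
      simp only [F1, AddMonoidHom.comp_apply, h1, hφ]
      simp
    rw [AddMonoidHom.add_apply, h0, h2, zero_add] at h
    exact hc0 h

/-! ### Copies of `ℚ` and `ℤ_[p]` in torsion-free groups -/

section Embeddings

variable {B : Type u} [AddCommGroup B]

/-- A nonzero divisible subgroup of a torsion-free group yields a copy of `ℚ`. -/
theorem exists_rat_embedding (htf : ∀ n : ℕ, 0 < n → ∀ b : B, n • b = 0 → b = 0)
    (D : AddSubgroup B) (hD0 : D ≠ ⊥) (hD : ∀ n : ℕ, 0 < n → ∀ d ∈ D, ∃ e ∈ D, n • e = d) :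
    ∃ i : ℚ →+ B, Function.Injective i := by
  obtain ⟨d, hdD, hd0⟩ := D.bot_or_exists_ne_zero.resolve_left hD0
  obtain ⟨φ, hφ⟩ := exists_extension_of_divisible (D := D) (fun n hn x => by
    obtain ⟨e, he, h⟩ := hD n.natAbs (Int.natAbs_pos.2 hn) x x.2
    rcases Int.natAbs_eq n with h' | h'
    · exact ⟨⟨e, he⟩, Subtype.ext (by
        rw [h', natCast_zsmul]
        exact h)⟩
    · exact ⟨⟨-e, D.neg_mem he⟩, Subtype.ext (by
        rw [h', AddSubgroup.coe_zsmul, neg_smul, smul_neg, neg_neg, natCast_zsmul, h])⟩)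
    (Int.castAddHom ℚ) Int.cast_injective (zmultiplesHom D ⟨d, hdD⟩)
  refine ⟨D.subtype.comp φ, (injective_iff_map_eq_zero _).2 fun q hq => ?_⟩
  have hq' : φ q = 0 := Subtype.ext hq
  have h1 : φ q.num = 0 := by
    rw [← Rat.mul_den_eq_num, mul_comm, ← nsmul_eq_mul, map_nsmul, hq', smul_zero]
  have h2 : q.num • d = 0 := by
    have := (hφ q.num).symm.trans h1
    simpa using congrArg Subtype.val this
  have h3 : q.num.natAbs • d = 0 := by
    rcases Int.natAbs_eq q.num with h' | h' <;> rw [h'] at h2 <;> simpa using h2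
  by_contra hne
  exact hd0 (htf _ (Int.natAbs_pos.2 (Rat.num_ne_zero.2 hne)) d h3)

theorem exists_nsmul_of_prime {D : AddSubgroup B}
    (hD : ∀ p : ℕ, p.Prime → ∀ d ∈ D, ∃ e ∈ D, p • e = d) (n : ℕ) (hn : 0 < n) :
    ∀ d ∈ D, ∃ e ∈ D, n • e = d := by
  induction n using induction_on_primes with
  | zero => omega
  | one => exact fun d hd => ⟨d, hd, one_smul _ _⟩
  | prime_mul p a hp ih =>
    intro d hd
    obtain ⟨e, he, rfl⟩ := hD p hp d hd
    obtain ⟨e', he', rfl⟩ := ih (Nat.pos_of_mul_pos_left hn) e he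
    exact ⟨e', he', mul_smul _ _ _⟩

/-- A nonzero homomorphism from `ℤ_[p]` to a torsion-free group is injective or has divisible
range. -/
theorem exists_rat_embedding_or_injective (htf : ∀ n : ℕ, 0 < n → ∀ b : B, n • b = 0 → b = 0)
    (p : ℕ) [hp : Fact p.Prime] (φ : ℤ_[p] →+ B) (hφ : φ ≠ 0) :
    (∃ i : ℚ →+ B, Function.Injective i) ∨ Function.Injective φ := by
  refine or_iff_not_imp_right.2 fun hinj => ?_
  obtain ⟨z, hz, hz0⟩ : ∃ z, φ z = 0 ∧ z ≠ 0 := by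
    by_contra! h
    exact hinj ((injective_iff_map_eq_zero φ).2 h)
  -- Write `z` as a unit times a power of `p`; torsion-freeness cancels the power.
  obtain ⟨u, hu⟩ : ∃ u : ℤ_[p]ˣ, φ u = 0 := by
    refine ⟨PadicInt.unitCoeff hz0, htf (p ^ z.valuation) (pow_pos hp.out.pos _) _ ?_⟩
    rw [← map_nsmul, nsmul_eq_mul, Nat.cast_pow, mul_comm, ← PadicInt.unitCoeff_spec hz0, hz]
  refine exists_rat_embedding htf φ.range (fun h => hφ (AddMonoidHom.range_eq_bot_iff.1 h))
    (exists_nsmul_of_prime fun q hq => ?_)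
  rintro _ ⟨w, rfl⟩
  by_cases hqp : q = p
  · subst hqp
    -- Reducing `w * u⁻¹` modulo `p` writes `w` as an integer multiple of `u`, which `φ` kills, plus
    -- `p` times `e * u`.
    obtain ⟨e, he⟩ := Ideal.mem_span_singleton.1 (PadicInt.appr_spec 1 (w * (↑u⁻¹ : ℤ_[q])))
    refine ⟨φ (e * (u : ℤ_[q])), ⟨_, rfl⟩, ?_⟩
    have hw : w = (w * (↑u⁻¹ : ℤ_[q])).appr 1 • (u : ℤ_[q]) + q • (e * (u : ℤ_[q])) := by
      have h1 : w * (↑u⁻¹ : ℤ_[q]) * (u : ℤ_[q]) = w := by rw [mul_assoc, Units.inv_mul, mul_one]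
      rw [nsmul_eq_mul, nsmul_eq_mul]
      linear_combination (u : ℤ_[q]) * he - h1
    conv_rhs => rw [hw, map_add, map_nsmul, hu, smul_zero, zero_add, map_nsmul]
  · have hunit : IsUnit (q : ℤ_[p]) := by
      rw [PadicInt.isUnit_iff, PadicInt.norm_natCast_eq_one_iff]
      exact (Nat.coprime_primes hp.out hq).2 (Ne.symm hqp)
    obtain ⟨v, hv⟩ := hunit
    refine ⟨φ (↑v⁻¹ * w), ⟨_, rfl⟩, ?_⟩
    rw [← map_nsmul, nsmul_eq_mul, ← hv, Units.mul_inv_cancel_left]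

end Embeddings

/-- Integers that are congruent to `1` modulo `p ^ n` and divisible by the prime-to-`p` part
of `n !`. -/
theorem exists_padic_idempotent (p : ℕ) (hp : p.Prime) (n : ℕ) :
    ∃ e : ℤ, (p : ℤ) ^ n ∣ e - 1 ∧ ((n.factorial : ℕ) : ℤ) ∣ e * (p : ℤ) ^ n := by
  have hcop : IsCoprime ((p : ℤ) ^ n) ((ordCompl[p] n.factorial : ℕ) : ℤ) := by
    refine IsCoprime.pow_left (Nat.isCoprime_iff_coprime.2 ?_)
    exact Nat.coprime_ordCompl hp n.factorial_ne_zero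
  obtain ⟨a, b, hab⟩ := hcop
  refine ⟨b * (ordCompl[p] n.factorial : ℕ), ⟨-a, by linear_combination hab⟩, ?_⟩
  -- Hence `p ^ n` absorbs the `p`-part of `n !`, and `e` supplies the rest.
  have h1 : n.factorial.factorization p ≤ n :=
    (Nat.factorization_factorial_le_div_pred hp n).trans (Nat.div_le_self _ _)
  have h2 : ((n.factorial : ℕ) : ℤ) =
      (p : ℤ) ^ n.factorial.factorization p * (ordCompl[p] n.factorial : ℕ) := by
    exact_mod_cast (Nat.ordProj_mul_ordCompl_eq_self n.factorial p).symm
  rw [h2, mul_assoc, mul_comm (_ ^ _)]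
  exact dvd_mul_of_dvd_right (mul_dvd_mul_left _ (pow_dvd_pow _ h1)) _

/-! ### Images of countably incomplete ultraproducts -/

section Incomplete

variable {I : Type v} {A : I → Type w} [∀ i, AddCommGroup (A i)] {B : Type u} [AddCommGroup B]

/-- Families that are divisible, along `U`, by every positive integer, can be divided by any
positive integer within the same class. -/
theorem exists_nsmul_eventually_of_tendsto {U : Ultrafilter I} {n : I → ℕ}
    (hn : Filter.Tendsto n U Filter.atTop) (x : ∀ i, A i)
    (hx : ∀ N : ℕ, 0 < N → ∀ᶠ i in (U : Filter I), ∃ y, N • y = x i) (N : ℕ) (hN : 0 < N) :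
    ∃ y : ∀ i, A i, (∀ M : ℕ, 0 < M → ∀ᶠ i in (U : Filter I), ∃ z, M • z = y i) ∧
      ∀ᶠ i in (U : Filter I), N • y i = x i := by
  classical
  -- The largest `j ≤ n i` for which `j !` divides `x i`; `j = 0` always qualifies. Along `U` it
  -- tends to infinity, so one quotient by `(m i)!` serves all divisors at once.
  let m : I → ℕ := fun i => Nat.findGreatest (fun j => ∃ z, j.factorial • z = x i) (n i)
  have hm : ∀ i, ∃ z, (m i).factorial • z = x i := fun i =>
    Nat.findGreatest_spec (P := fun j => ∃ z, j.factorial • z = x i) (Nat.zero_le (n i))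
      ⟨x i, one_smul _ _⟩
  have hlarge : ∀ J : ℕ, ∀ᶠ i in (U : Filter I), J ≤ m i := fun J => by
    filter_upwards [hn.eventually_ge_atTop J, hx _ J.factorial_pos] with i h1 h2
    exact Nat.le_findGreatest h1 h2
  choose z hz using hm
  refine ⟨fun i => ((m i).factorial / N) • z i, fun M hM => ?_, ?_⟩
  · filter_upwards [hlarge (N * M)] with i hi
    obtain ⟨k, hk⟩ : N * M ∣ (m i).factorial := Nat.dvd_factorial (Nat.mul_pos hN hM) hi
    refine ⟨k • z i, ?_⟩
    rw [hk, mul_assoc, Nat.mul_div_cancel_left _ hN, mul_smul]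
  · filter_upwards [hlarge N] with i hi
    rw [← mul_smul, Nat.mul_div_cancel' (Nat.dvd_factorial hN hi), hz]

/-- A nonzero homomorphic image of an ultraproduct by a countably incomplete ultrafilter has
torsion or contains `ℚ` or some `ℤ_[p]`. -/
theorem exists_torsion_or_embedding_of_tendsto {U : Ultrafilter I} {n : I → ℕ}
    (hn : Filter.Tendsto n U Filter.atTop) (F : (∀ i, A i) →+ B) (hF0 : F ≠ 0)
    (hF : ∀ x, (∀ᶠ i in (U : Filter I), x i = 0) → F x = 0) :
    (∃ b : B, b ≠ 0 ∧ IsOfFinAddOrder b) ∨ (∃ i : ℚ →+ B, Function.Injective i) ∨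
      (∃ (p : ℕ) (_ : Fact p.Prime) (i : ℤ_[p] →+ B), Function.Injective i) := by
  refine or_iff_not_imp_left.2 fun htor => or_iff_not_imp_left.2 fun hQ => ?_
  have htf : ∀ n : ℕ, 0 < n → ∀ b : B, n • b = 0 → b = 0 := fun n hn b hb => by
    by_contra hb0
    exact htor ⟨b, hb0, isOfFinAddOrder_iff_nsmul_eq_zero.2 ⟨n, hn, hb⟩⟩
  have hcongr : ∀ x y, (∀ᶠ i in (U : Filter I), x i = y i) → F x = F y := fun x y h => by
    rw [← sub_eq_zero, ← map_sub]
    exact hF _ (h.mono fun i hi => sub_eq_zero.2 hi)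
  let X : AddSubgroup (∀ i, A i) :=
    { carrier := {x | ∀ N : ℕ, 0 < N → ∀ᶠ i in (U : Filter I), ∃ y, N • y = x i}
      zero_mem' := fun N _ => Filter.Eventually.of_forall fun i => ⟨0, smul_zero N⟩
      add_mem' := fun {x y} hx hy N hN => by
        filter_upwards [hx N hN, hy N hN] with i ⟨a, ha⟩ ⟨b, hb⟩
        exact ⟨a + b, by rw [smul_add, ha, hb, Pi.add_apply]⟩
      neg_mem' := fun {x} hx N hN => by
        filter_upwards [hx N hN] with i ⟨a, ha⟩
        exact ⟨-a, by rw [smul_neg, ha, Pi.neg_apply]⟩ }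
  have hX : ∀ x ∈ X, F x = 0 := by
    by_contra! h
    obtain ⟨x, hx, hx0⟩ := h
    refine hQ (exists_rat_embedding htf (X.map F) (fun hbot => hx0 ?_) fun N hN => ?_)
    · rw [← AddSubgroup.mem_bot, ← hbot]
      exact ⟨x, hx, rfl⟩
    · rintro _ ⟨x, hx, rfl⟩
      obtain ⟨y, hy, hxy⟩ := exists_nsmul_eventually_of_tendsto hn x hx N hN
      exact ⟨F y, ⟨y, hy, rfl⟩, by rw [← map_nsmul]; exact hcongr _ _ hxy⟩
  obtain ⟨p, hp, a, ha⟩ : ∃ p : ℕ, p.Prime ∧ ∃ a, ∀ y, p • F y ≠ F a := by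
    by_contra! h
    refine hQ (exists_rat_embedding htf F.range (fun h => hF0 (AddMonoidHom.range_eq_bot_iff.1 h))
      (exists_nsmul_of_prime fun p hp => ?_))
    rintro _ ⟨x, rfl⟩
    obtain ⟨y, hy⟩ := h p hp x
    exact ⟨F y, ⟨y, rfl⟩, hy⟩
  have : Fact p.Prime := ⟨hp⟩
  choose e he1 he0 using exists_padic_idempotent p hp
  -- The approximations `appr` are additive only modulo `p ^ n i`. The factor `e (n i)` makes the
  -- defect divisible by `(n i)!`, so it lies in `X` and `F` kills it.
  let φ : ℤ_[p] →+ B := AddMonoidHom.mk'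
    (fun z => F fun i => (e (n i) * (z.appr (n i) : ℤ)) • a i) fun z w => by
      rw [← sub_eq_zero, ← map_add, ← map_sub]
      refine hX _ fun N hN => ?_
      filter_upwards [hn.eventually_ge_atTop N] with i hi
      have h1 : (p : ℤ) ^ n i ∣ (z + w).appr (n i) - (z.appr (n i) + w.appr (n i)) := by
        rw [← PadicInt.pow_p_dvd_int_iff]
        have h := fun x : ℤ_[p] => Ideal.mem_span_singleton.1 (PadicInt.appr_spec (n i) x)
        have := dvd_sub (dvd_add (h z) (h w)) (h (z + w))
        push_cast
        convert this using 1
        ring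
      obtain ⟨k, hk⟩ : (N : ℤ) ∣ e (n i) * ((z + w).appr (n i) - (z.appr (n i) + w.appr (n i))) :=
        (Int.natCast_dvd_natCast.2 (Nat.dvd_factorial hN hi)).trans
          ((he0 (n i)).trans (mul_dvd_mul_left _ h1))
      refine ⟨k • a i, ?_⟩
      simp only [Pi.sub_apply, Pi.add_apply]
      rw [← natCast_zsmul, ← mul_smul, ← hk, ← add_smul, ← sub_smul]
      congr 1
      ring
  -- Since `e (n i)` and `appr` of 1 are both 1 modulo `p` when `n i > 0`, `φ 1` differs from `F a`
  -- by a `p`-multiple in the range; `φ 1 = 0` would contradict the choice of `a`.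
  have hφ : φ ≠ 0 := fun h0 => by
    have hdvd : ∀ i, 0 < n i → ∃ l : ℤ, 1 - e (n i) * ((1 : ℤ_[p]).appr (n i) : ℤ) = p * l := by
      intro i hi
      have h1 : (p : ℤ) ^ n i ∣ 1 - (1 : ℤ_[p]).appr (n i) := by
        rw [← PadicInt.pow_p_dvd_int_iff]
        push_cast
        exact Ideal.mem_span_singleton.1 (PadicInt.appr_spec (n i) 1)
      have h2 : (p : ℤ) ^ n i ∣ 1 - e (n i) * ((1 : ℤ_[p]).appr (n i) : ℤ) := by
        have h3 := dvd_sub h1 ((he1 (n i)).mul_right ((1 : ℤ_[p]).appr (n i) : ℤ))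
        rwa [sub_one_mul, sub_sub, add_sub_cancel] at h3
      exact (dvd_pow_self _ hi.ne').trans h2
    choose l hl using hdvd
    refine ha (fun i => if h : 0 < n i then l i h • a i else 0) ?_
    have h1 : φ 1 = 0 := by rw [h0]; rfl
    rw [← map_nsmul, ← sub_zero (F a), ← h1]
    refine (hcongr _ (a - fun i => (e (n i) * ((1 : ℤ_[p]).appr (n i) : ℤ)) • a i) ?_).trans
      (map_sub F _ _)
    filter_upwards [hn.eventually_gt_atTop 0] with i hi
    rw [Pi.smul_apply, dif_pos hi, Pi.sub_apply, ← natCast_zsmul, ← mul_smul, ← hl i hi, sub_smul,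
      one_smul]
  exact ⟨p, ⟨hp⟩, φ, (exists_rat_embedding_or_injective htf p φ hφ).resolve_left hQ⟩

theorem exists_torsion_or_embedding {f : (∀ i, A i) →+ B} (h1 : FactorsThroughUltraproducts f)
    (h2 : ¬ FactorsThroughCountablyCompleteUltraproducts f) :
    (∃ b : B, b ≠ 0 ∧ IsOfFinAddOrder b) ∨ (∃ i : ℚ →+ B, Function.Injective i) ∨
      (∃ (p : ℕ) (_ : Fact p.Prime) (i : ℤ_[p] →+ B), Function.Injective i) := by
  obtain ⟨m, U, F, hF, hf⟩ := (factorsThroughUltraproducts_iff_sum f).1 h1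
  by_contra hB
  refine h2 ((factorsThroughCountablyCompleteUltraproducts_iff_sum f).2 ?_)
  have hV : ∀ k, ∃ V : Ultrafilter I, CountableInterFilter (V : Filter I) ∧
      ∀ x, (∀ᶠ i in (V : Filter I), x i = 0) → F k x = 0 := fun k => by
    by_cases hU : CountableInterFilter (U k : Filter I)
    · exact ⟨U k, hU, hF k⟩
    · obtain ⟨n, hn⟩ := (U k).exists_tendsto_atTop_of_not_countableInterFilter hU
      obtain ⟨i⟩ := (U k).neBot.nonempty
      have hk : F k = 0 := by
        by_contra h
        exact hB (exists_torsion_or_embedding_of_tendsto hn (F k) h (hF k))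
      -- A zero summand may be assigned any ultrafilter; a principal one is countably complete.
      exact ⟨pure i, ⟨fun S _ h => Set.mem_sInter.2 h⟩, fun x _ => by rw [hk]; rfl⟩
  choose V hV hFV using hV
  exact ⟨m, V, F, hV, hFV, hf⟩

end Incomplete

theorem theorem5p6 (B : Type u) [AddCommGroup B] :
    List.TFAE [
      -- an arbitrary index set, `f` surjective
      ∃ (I : Type u) (A : I → Type u) (_ : ∀ i, AddCommGroup (A i)) (f : (∀ i, A i) →+ B),
        Function.Surjective f ∧ FactorsThroughUltraproducts f ∧
          ¬ FactorsThroughCountablyCompleteUltraproducts f,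
      -- a countable product, `f` surjective
      ∃ (A : ℕ → Type u) (_ : ∀ n, AddCommGroup (A n)) (f : (∀ n, A n) →+ B),
        Function.Surjective f ∧ FactorsThroughUltraproducts f ∧
          ¬ FactorsThroughFiniteSubproduct f,
      -- a nontrivial cotorsion subgroup
      ∃ C : AddSubgroup B, C ≠ ⊥ ∧ IsCotorsion C,
      -- torsion, or a copy of `ℚ`, or a copy of the `p`-adic integers
      (∃ b : B, b ≠ 0 ∧ IsOfFinAddOrder b) ∨
        (∃ i : ℚ →+ B, Function.Injective i) ∨
        (∃ (p : ℕ) (_ : Fact p.Prime) (i : ℤ_[p] →+ B), Function.Injective i),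
      -- a nontrivial algebraically compact subgroup
      ∃ C : AddSubgroup B, C ≠ ⊥ ∧ IsAlgebraicallyCompact C,
      -- an arbitrary index set, `f` not assumed surjective
      ∃ (I : Type u) (A : I → Type u) (_ : ∀ i, AddCommGroup (A i)) (f : (∀ i, A i) →+ B),
        FactorsThroughUltraproducts f ∧ ¬ FactorsThroughCountablyCompleteUltraproducts f,
      -- a countable product, `f` not assumed surjective
      ∃ (A : ℕ → Type u) (_ : ∀ n, AddCommGroup (A n)) (f : (∀ n, A n) →+ B),
        FactorsThroughUltraproducts f ∧ ¬ FactorsThroughFiniteSubproduct f] := by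
  tfae_have 4 → 5 := exists_isAlgebraicallyCompact_addSubgroup
  tfae_have 5 → 3 := fun ⟨C, hC0, hC⟩ => ⟨C, hC0, hC.isCotorsion⟩
  tfae_have 3 → 2 := fun ⟨_, hC0, hC⟩ => exists_surjective_of_isCotorsion hC0 hC
  tfae_have 2 → 1 := fun ⟨A, _, f, hs, h1, h2⟩ => by
    obtain ⟨f', hf', h1', h2'⟩ := not_factorsThroughCountablyComplete_ulift.{u, u, u} h1 h2
    exact ⟨ULift ℕ, fun i => A i.down, inferInstance, f', fun b => hf' b (hs b), h1', h2'⟩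
  tfae_have 2 → 7 := fun ⟨A, i, f, _, h⟩ => ⟨A, i, f, h⟩
  tfae_have 1 → 6 := fun ⟨I, A, i, f, _, h⟩ => ⟨I, A, i, f, h⟩
  tfae_have 7 → 6 := fun ⟨A, _, f, h1, h2⟩ => by
    obtain ⟨f', -, h⟩ := not_factorsThroughCountablyComplete_ulift.{u, u, u} h1 h2
    exact ⟨ULift ℕ, fun i => A i.down, inferInstance, f', h⟩
  tfae_have 6 → 4 := fun ⟨_, _, _, _, h1, h2⟩ => exists_torsion_or_embedding h1 h2
  tfae_finish
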